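/- Let $k\ge 1$. A \emph{$k$-tree} is a graph built from a $(k+1)$-clique by repeatedly adding a new vertex $z$ adjacent to exactly the vertices of some $k$-clique of the current graph. For a spanning subgraph $T$ of a connected graph $G$, $T$ is an \emph{additive $+c$ spanner} of $G$ if $d_T(u,v)\le d_G(u,v)+c$ for all vertices $u,v$ (with $d_T(u,v)=\infty$ if $u,v$ are not connected in $T$). For $k\ge 3$ and $h\ge 0$ the \emph{$(k,h)$-snowflake} $S(k,h)$ is defined as follows. A \emph{$-v$ child} of a $(k+1)$-clique $K$, where $v\in K$, is the $(k+1)$-clique $(K\setminus\{v\})\cup\{z\}$, obtained by adding a new vertex $z$ adjacent to exactly the vertices of $K\setminus\{v\}$. $S(k,0)$ is a $(k+1)$-clique $K_B$, which has height $0$. $S(k,1)$ is obtained from it by creating $\lceil k/2\rceil$ distinct $-v$ children of $K_B$ for each $v\in K_B$; these have height $1$. For $1<i\le h$, $S(k,i)$ is obtained from $S(k,i-1)$ by creating, for every clique $K$ of height $i-1$ and every $v\in K$ other than the vertex whose introduction created $K$, exactly one $-v$ child of $K$; these have height $i$. \textbf{Theorem.} For all integers $c\ge 1$ and $k\ge 3$,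 the snowflake $G=S(k,kc^2)$ is a $k$-tree, it has treewidth exactly $k$, and no additive $+c$ spanner of $G$ has treewidth at most $k-1$. In particular, for every $k\ge3$ there is no constant $c$ such that every finite connected graph of treewidth $k$ has an additive $+c$ spanner of treewidth at most $k-1$. -/

import Mathlib

namespace SpannerTreewidth

/-! ### Tree decompositions and treewidth -/

/-- A tree decomposition of `G` whose tree has node type `ι`. -/
structure TreeDecomposition {V : Type*} (G : SimpleGraph V) (ι : Type*) where
  /-- the underlying tree -/
  tree : SimpleGraph ι
  isTree : tree.IsTree
  /-- the bag attached to each node -/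
  bag : ι → Finset V
  exists_vertex_mem : ∀ v, ∃ i, v ∈ bag i
  exists_edge_mem : ∀ u v, G.Adj u v → ∃ i, u ∈ bag i ∧ v ∈ bag i
  /-- the nodes whose bags contain a given vertex induce a connected subtree -/
  preconnected : ∀ v, (tree.induce {i | v ∈ bag i}).Preconnected

/-- The width of a tree decomposition over a finite tree: largest bag size minus one. -/
def TreeDecomposition.width {V ι : Type*} [Fintype ι] {G : SimpleGraph V}
    (D : TreeDecomposition G ι) : ℕ :=
  (Finset.univ.sup fun i => (D.bag i).card) - 1

/-- The treewidth of `G`: the least width of a tree decomposition of `G` over a finite tree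
(and `⊤` if there is none, which can only happen for infinite `G`). -/
noncomputable def treewidth {V : Type*} (G : SimpleGraph V) : ℕ∞ :=
  ⨅ (ι : Type) (_ : Fintype ι) (D : TreeDecomposition G ι), (D.width : ℕ∞)

/-! ### Additive spanners -/

/-- `T` is an additive `c`-spanner of `G`: a spanning subgraph of `G` in which the distance
between any two vertices is at most `c` plus their distance in `G`. The distance is
`⊤` between vertices in different components. -/
def IsAdditiveSpanner {V : Type*} (c : ℕ) (T G : SimpleGraph V) : Prop :=
  T ≤ G ∧ ∀ u v, T.edist u v ≤ G.edist u v + (c : ℕ∞)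

/-! ### `k`-trees -/

/-- `KTreeOn k G S` says that the subgraph of `G` induced on the vertex set `S` is a `k`-tree:
a `(k+1)`-clique is one, and so is every graph arising from a `k`-tree by adding a new
vertex `z` whose neighbours are exactly the members of some `k`-clique `K` of it. -/
inductive KTreeOn {V : Type*} (k : ℕ) (G : SimpleGraph V) : Set V → Prop
  | base (K : Finset V) (hK : G.IsNClique (k + 1) K) : KTreeOn k G (K : Set V)
  | step (S : Set V) (hS : KTreeOn k G S) (K : Finset V) (hKS : (K : Set V) ⊆ S)
      (hK : G.IsNClique k K) (z : V) (hz : z ∉ S) (hadj : ∀ v ∈ S, G.Adj z v ↔ v ∈ K) :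
      KTreeOn k G (insert z S)

/-- `G` is a `k`-tree. -/
def IsKTree {V : Type*} (k : ℕ) (G : SimpleGraph V) : Prop :=
  KTreeOn k G Set.univ

/-! ### Snowflakes

Every `(k+1)`-clique of the construction tree is listed as a family indexed by the
`k + 1` positions in `Fin (k + 1)`. Vertex `s` of the base clique has position `s`, and the
new vertex of a `-v` child of `K` takes over the position of the vertex `v` that it replaces.
So a `-v` child of `K` is given by a position, and a clique of the construction tree other
than the root is given by the sequence of positions that are replaced on the way from the root
to it, together with a number `j < ⌈k/2⌉` telling which of the `⌈k/2⌉` children of the root for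
the first position is taken. Sequences are lists with the most recent position at the head. -/

/-- Names for the vertices of snowflakes. `⌈k/2⌉` is `(k + 1) / 2`. -/
inductive SnowVertex (k : ℕ) : Type
  /-- the vertex of the base clique at position `s` -/
  | base (s : Fin (k + 1))
  /-- the vertex created with the child, for position `i`, of the clique reached by `l`
  (for the root, `l = []`, this is the `j`-th of the children for position `i`) -/
  | new (j : Fin ((k + 1) / 2)) (i : Fin (k + 1)) (l : List (Fin (k + 1)))

/-- The vertex at a given position of the clique reached by `l` through the `j`-th copy. -/
def cliqueVertex {k : ℕ} (j : Fin ((k + 1) / 2)) :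
    List (Fin (k + 1)) → Fin (k + 1) → SnowVertex k
  | [], s => .base s
  | i :: l, s => if s = i then .new j i l else cliqueVertex j l s

/-- The names that occur in the snowflake of height `h`: all base vertices, and the new
vertices at height (length of the sequence) at most `h`. A clique other than the root has no
child replacing its own most recent vertex, so consecutive positions differ. -/
def SnowVertex.Occurs {k : ℕ} (h : ℕ) : SnowVertex k → Prop
  | .base _ => True
  | .new _ i l => (i :: l).IsChain (· ≠ ·) ∧ (i :: l).length ≤ h

/-- `v.JoinedTo u`: either `v` and `u` are distinct base vertices, or `v` is the new vertex of a
`-x` child of a clique `K` and `u ∈ K \ {x}`. -/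
def SnowVertex.JoinedTo {k : ℕ} : SnowVertex k → SnowVertex k → Prop
  | .base s, u => ∃ t, t ≠ s ∧ u = .base t
  | .new j i l, u => ∃ t, t ≠ i ∧ u = cliqueVertex j l t

/-- The `(k, h)`-snowflake `S(k, h)`. -/
def snowflake (k h : ℕ) : SimpleGraph {v : SnowVertex k // v.Occurs h} :=
  SimpleGraph.fromRel fun v u => v.1.JoinedTo u.1

end SpannerTreewidth

/-! The construction cliques form a tree decomposition of the snowflake of width `k`, and the base
clique forces equality. To show that a spanner `T` has treewidth at least `k`, it suffices to find a
complete minor on `k + 1` branch sets in `T`: by the Helly property of subtrees, some bag meets all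
of them (`exists_card_le_bag`).

The minor sits at the base clique. Every pair of base vertices is assigned a child of the base
clique that keeps both, and the `⌈k/2⌉` copies per position allow the assigned children to be
distinct. It remains to link the pair in `T` below its child, and for this each of the two vertices
is linked to the new vertex of the child (`IsSpannerBelow.reachableIn`).

Suppose this fails for a base vertex `u`, and let `R` consist of `u` and the vertices below the
child. Vertices of a common clique have distance at most `c + 1` in `T`, but if they are not linked
inside `R`, a walk between them must leave `R` and is at least as long as the sum of their distances
to the outside. New vertices are further from the outside, since a clique separates what is below
it. A split clique at distance `p` satisfies `2 * p ≤ c`, so a contradiction follows once `p` can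
always be raised (`exists_isSplit_succ`).

The only obstacle to raising `p` is a vertex `b` that stays near the outside and is linked to no
other vertex of its clique, so that replacing `b` destroys the split. But then the vertices above
cannot escape through `b`, and each round of replacing the other `k` vertices raises their distance
`q`. This contradicts `p + q ≤ c` (`not_isIsolated`). Raising `p` by one thus costs at most `c * k`
heights, and about `c / 2` raises fit into height `k * c ^ 2`. -/

namespace SpannerTreewidth

/-! ### Reachability inside a set of vertices -/

/-- `x` and `y` are joined by a walk of `G` all of whose vertices lie in `R`. -/
def ReachableIn {V : Type*} (G : SimpleGraph V) (R : Set V) (x y : V) : Prop :=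
  ∃ p : G.Walk x y, ∀ v ∈ p.support, v ∈ R

namespace ReachableIn

variable {V : Type*} {G : SimpleGraph V} {R R' : Set V} {x y z : V}

theorem refl (hx : x ∈ R) : ReachableIn G R x x :=
  ⟨.nil, by simpa using hx⟩

theorem symm (h : ReachableIn G R x y) : ReachableIn G R y x := by
  obtain ⟨p, hp⟩ := h
  exact ⟨p.reverse, fun v hv => hp v (by simpa using hv)⟩

theorem trans (h : ReachableIn G R x y) (h' : ReachableIn G R y z) : ReachableIn G R x z := by
  obtain ⟨p, hp⟩ := h
  obtain ⟨q, hq⟩ := h'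
  refine ⟨p.append q, fun v hv => ?_⟩
  rcases (SimpleGraph.Walk.mem_support_append_iff p q).1 hv with h | h
  exacts [hp v h, hq v h]

theorem mono (hR : R ⊆ R') (h : ReachableIn G R x y) : ReachableIn G R' x y := by
  obtain ⟨p, hp⟩ := h
  exact ⟨p, fun v hv => hR (hp v hv)⟩

theorem right_mem (h : ReachableIn G R x y) : y ∈ R := by
  obtain ⟨p, hp⟩ := h
  exact hp y p.end_mem_support

theorem left_mem (h : ReachableIn G R x y) : x ∈ R := h.symm.right_mem

theorem of_adj (h : G.Adj x y) (hx : x ∈ R) (hy : y ∈ R) : ReachableIn G R x y :=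
  ⟨.cons h .nil, by simp [hx, hy]⟩

theorem not_or_not (h : ¬ ReachableIn G R x y) (z : V) :
    ¬ ReachableIn G R z x ∨ ¬ ReachableIn G R z y := by
  by_contra! hc
  exact h (hc.1.symm.trans hc.2)

end ReachableIn

theorem reachableIn_of_preconnected_induce {V : Type*} {G : SimpleGraph V} {R : Set V}
    (h : (G.induce R).Preconnected) {x y : V} (hx : x ∈ R) (hy : y ∈ R) :
    ReachableIn G R x y := by
  obtain ⟨p⟩ := h ⟨x, hx⟩ ⟨y, hy⟩
  have hp : ∀ v ∈ (p.map (SimpleGraph.Embedding.induce R).toHom).support, v ∈ R := by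
    intro v hv
    rw [SimpleGraph.Walk.support_map, List.mem_map] at hv
    obtain ⟨w, -, rfl⟩ := hv
    exact w.2
  exact ⟨_, hp⟩

theorem preconnected_induce_of_reachableIn {V : Type*} {G : SimpleGraph V} {R : Set V}
    (h : ∀ x ∈ R, ∀ y ∈ R, ReachableIn G R x y) : (G.induce R).Preconnected := by
  rintro ⟨x, hx⟩ ⟨y, hy⟩
  obtain ⟨p, hp⟩ := h x hx y hy
  exact ⟨p.induce R hp⟩

/-! ### The Helly property of subtrees -/

section Helly

variable {ι : Type*} {G : SimpleGraph ι}

/-- If a walk in `A` followed by a walk in `B` leads from `i ∉ B` to `s`, then the first step of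
the path from `i` to `s` in an acyclic graph stays in `A`. -/
theorem mem_of_isPath_cons (hG : G.IsAcyclic) {A B : Set ι} {i i' s x : ι} (hadj : G.Adj i i')
    (p : G.Walk i' s) (hp : (SimpleGraph.Walk.cons hadj p).IsPath) (hi : i ∉ B)
    (hA : ReachableIn G A i x) (hB : ReachableIn G B x s) : i' ∈ A := by
  classical
  obtain ⟨q, hq⟩ := hA
  obtain ⟨r, hr⟩ := hB
  -- Shortcutting the combined walk gives the unique path, so the first edge of that path occurs in
  -- the walk. It cannot occur in the part through `B`, as `i ∉ B`.
  have huniq : (q.append r).bypass = SimpleGraph.Walk.cons hadj p := by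
    have := (hG.subsingleton_path _ _).elim ⟨_, (q.append r).bypass_isPath⟩ ⟨_, hp⟩
    exact congrArg Subtype.val this
  have hmem : s(i, i') ∈ (q.append r).edges := by
    apply SimpleGraph.Walk.edges_bypass_subset_edges
    rw [huniq]
    simp
  rw [SimpleGraph.Walk.edges_append, List.mem_append] at hmem
  rcases hmem with h | h
  · exact hq _ (q.snd_mem_support_of_mem_edges h)
  · exact absurd (hr _ (r.fst_mem_support_of_mem_edges h)) hi

/-- The first node of the path that lies in `B` works: before reaching `B` the path cannot leave any
`S j`, because `S j` itself offers a way into `B`. -/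
theorem exists_mem_of_walk {κ : Type*} (hG : G.IsAcyclic) (S : κ → Set ι) (B : Set ι)
    (hB : ∀ x ∈ B, ∀ y ∈ B, ReachableIn G B x y)
    (hS : ∀ j, ∀ x ∈ S j, ∀ y ∈ S j, ReachableIn G (S j) x y)
    (hSB : ∀ j, (S j ∩ B).Nonempty) {i s : ι} (p : G.Walk i s) (hp : p.IsPath) (hs : s ∈ B)
    (hi : ∀ j, i ∈ S j) : ∃ i' ∈ B, ∀ j, i' ∈ S j := by
  induction p with
  | nil => exact ⟨_, hs, hi⟩
  | @cons i i' s hadj p ih =>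
    by_cases hiB : i ∈ B
    · exact ⟨i, hiB, hi⟩
    · refine ih hp.of_cons hs fun j => ?_
      obtain ⟨x, hxS, hxB⟩ := hSB j
      exact mem_of_isPath_cons hG hadj p hp hiB (hS j i (hi j) x hxS) (hB x hxB _ hs)

/-- Pairwise intersecting subtrees of a tree have a common node. -/
theorem helly_subtrees {κ : Type*} [Finite κ] (hG : G.IsTree) (S : κ → Set ι)
    (hS : ∀ j, ∀ x ∈ S j, ∀ y ∈ S j, ReachableIn G (S j) x y)
    (hSS : ∀ j j', (S j ∩ S j').Nonempty) : ∃ i, ∀ j, i ∈ S j := by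
  classical
  have := Fintype.ofFinite κ
  suffices h : ∀ F : Finset κ, ∃ i, ∀ j ∈ F, i ∈ S j by
    obtain ⟨i, hi⟩ := h Finset.univ
    exact ⟨i, fun j => hi j (Finset.mem_univ j)⟩
  intro F
  induction F using Finset.induction_on with
  | empty =>
    obtain ⟨i⟩ := hG.connected.nonempty
    exact ⟨i, by simp⟩
  | insert a F _ ih =>
    obtain ⟨i, hi⟩ := ih
    obtain ⟨s, hs, -⟩ := hSS a a
    obtain ⟨p, hp⟩ := (hG.connected.preconnected i s).exists_isPath
    obtain ⟨i', hi', h⟩ := exists_mem_of_walk hG.isAcyclic (fun j : F => S j) (S a) (hS a)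
      (fun j => hS j) (fun j => hSS j a) p hp hs (fun j => hi j j.2)
    refine ⟨i', fun j hj => ?_⟩
    rcases Finset.mem_insert.1 hj with rfl | hj
    · exact hi'
    · exact h ⟨j, hj⟩

end Helly

/-! ### Complete minors force large bags -/

section Minor

variable {V ι : Type*} {T : SimpleGraph V} {tree : SimpleGraph ι} {bag : ι → Finset V}

/-- Consecutive vertices of a walk share a bag, so the subtrees belonging to them overlap and their
union is connected. -/
theorem reachableIn_bags (hedge : ∀ u v, T.Adj u v → ∃ i, u ∈ bag i ∧ v ∈ bag i)
    (hconn : ∀ v, (tree.induce {i | v ∈ bag i}).Preconnected) {A : Set V} {a b : V}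
    (hab : ReachableIn T A a b) {i i' : ι} (hi : a ∈ bag i) (hi' : b ∈ bag i') :
    ReachableIn tree {i | ∃ v ∈ A, v ∈ bag i} i i' := by
  obtain ⟨p, hp⟩ := hab
  have single : ∀ v ∈ A, ∀ i i', v ∈ bag i → v ∈ bag i' →
      ReachableIn tree {i | ∃ v ∈ A, v ∈ bag i} i i' := fun v hv i i' hi hi' =>
    (reachableIn_of_preconnected_induce (hconn v) hi hi').mono fun x hx => ⟨v, hv, hx⟩
  induction p generalizing i with
  | nil => exact single _ (hp _ (by simp)) _ _ hi hi'
  | cons h p ih =>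
    obtain ⟨m, hm, hm'⟩ := hedge _ _ h
    refine (single _ (hp _ (by simp)) _ _ hi hm).trans (ih hm' hi' fun v hv => hp v ?_)
    simp [hv]

/-- If `T` has a complete minor with branch sets `A s`, then every tree decomposition of `T` has
a bag that meets all of them. -/
theorem exists_card_le_bag {κ : Type*} [Fintype κ] [Nontrivial κ] (htree : tree.IsTree)
    (hedge : ∀ u v, T.Adj u v → ∃ i, u ∈ bag i ∧ v ∈ bag i)
    (hconn : ∀ v, (tree.induce {i | v ∈ bag i}).Preconnected) (A : κ → Set V)
    (hA : ∀ s, ∀ a ∈ A s, ∀ b ∈ A s, ReachableIn T (A s) a b)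
    (hdisj : ∀ s t, s ≠ t → Disjoint (A s) (A t))
    (hadj : ∀ s t, s ≠ t → ∃ a ∈ A s, ∃ b ∈ A t, T.Adj a b) :
    ∃ i, Fintype.card κ ≤ (bag i).card := by
  obtain ⟨i, hi⟩ := helly_subtrees htree (fun s => {i | ∃ v ∈ A s, v ∈ bag i})
    (by
      rintro s i ⟨v, hv, hvi⟩ i' ⟨v', hv', hvi'⟩
      exact reachableIn_bags hedge hconn (hA s v hv v' hv') hvi hvi')
    (by
      intro s t
      rcases eq_or_ne s t with rfl | hst
      · obtain ⟨t, hst⟩ := exists_ne s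
        obtain ⟨a, ha, b, hb, hab⟩ := hadj s t hst.symm
        obtain ⟨i, hi, -⟩ := hedge _ _ hab
        exact ⟨i, ⟨a, ha, hi⟩, ⟨a, ha, hi⟩⟩
      · obtain ⟨a, ha, b, hb, hab⟩ := hadj s t hst
        obtain ⟨i, hi, hi'⟩ := hedge _ _ hab
        exact ⟨i, ⟨a, ha, hi⟩, ⟨b, hb, hi'⟩⟩)
  choose f hf hfi using hi
  refine ⟨i, ?_⟩
  rw [← Finset.card_univ]
  refine Finset.card_le_card_of_injOn f (fun s _ => hfi s) fun s _ t _ hst => ?_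
  by_contra hne
  exact Set.disjoint_left.1 (hdisj s t hne) (hf s) (hst ▸ hf t)

end Minor

/-! ### Trees from parent functions -/

/-- The graph joining every element to its parent is a tree if ranks decrease towards the root. -/
theorem isTree_of_parent {ι : Type*} [Fintype ι] (parent : ι → ι) (rank : ι → ℕ) (r : ι)
    (hrank : ∀ x, x ≠ r → rank (parent x) < rank x) :
    (SimpleGraph.fromRel fun x y => x ≠ r ∧ y = parent x).IsTree := by
  classical
  set G := SimpleGraph.fromRel fun x y => x ≠ r ∧ y = parent x with hG
  have hreach : ∀ n x, rank x = n → G.Reachable x r := by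
    intro n
    induction n using Nat.strong_induction_on with
    | _ n ih =>
      intro x hx
      rcases eq_or_ne x r with rfl | hxr
      · rfl
      · have hlt := hrank x hxr
        have hadj : G.Adj x (parent x) := by
          rw [hG, SimpleGraph.fromRel_adj]
          refine ⟨fun h => ?_, .inl ⟨hxr, rfl⟩⟩
          rw [← h] at hlt
          exact lt_irrefl _ hlt
        exact hadj.reachable.trans (ih _ (hx ▸ hlt) _ rfl)
  have hconn : G.Connected :=
    { preconnected := fun x y => (hreach _ x rfl).trans (hreach _ y rfl).symm
      nonempty := ⟨r⟩ }
  rw [SimpleGraph.isTree_iff_connected_and_card]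
  refine ⟨hconn, le_antisymm ?_ ?_⟩
  · have hsub : G.edgeSet ⊆ (fun x => s(x, parent x)) '' {x | x ≠ r} := by
      intro e
      induction e using Sym2.ind with
      | _ x y =>
        rw [SimpleGraph.mem_edgeSet, hG, SimpleGraph.fromRel_adj]
        rintro ⟨-, ⟨h, rfl⟩ | ⟨h, rfl⟩⟩
        · exact ⟨x, h, rfl⟩
        · exact ⟨y, h, Sym2.eq_swap⟩
    have h1 := Set.ncard_le_ncard hsub (Set.toFinite _)
    have h2 := Set.ncard_image_le (f := fun x => s(x, parent x)) (Set.toFinite {x | x ≠ r})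
    have h3 : {x | x ≠ r}.ncard + 1 = Nat.card ι := by
      have := Set.ncard_add_ncard_compl {r}
      rw [Set.ncard_singleton] at this
      rw [← this, add_comm]
      rfl
    have h4 : Nat.card G.edgeSet = G.edgeSet.ncard := rfl
    omega
  · exact hconn.card_vert_le_card_edgeSet_add_one

/-! ### Distance to the outside of a set -/

/-- Every walk from `x` to the outside of `R` has length at least `n`. -/
def Far {V : Type*} (T : SimpleGraph V) (R : Set V) (n : ℕ) (x : V) : Prop :=
  ∀ y ∉ R, ∀ p : T.Walk x y, n ≤ p.length

namespace Far

variable {V : Type*} {T : SimpleGraph V} {R : Set V} {m n : ℕ} {x y : V}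

theorem mono (h : Far T R n x) (hmn : m ≤ n) : Far T R m x :=
  fun y hy p => hmn.trans (h y hy p)

theorem one_of_mem (hx : x ∈ R) : Far T R 1 x := by
  rintro y hy (_ | ⟨h, p⟩)
  · exact absurd hx hy
  · simp

theorem mem (h : Far T R n x) (hn : 1 ≤ n) : x ∈ R := by
  by_contra hx
  have := h x hx .nil
  simp at this
  omega

/-- Vertices of `R` that are not linked inside `R` are as far apart as a detour through the
outside of `R` takes. -/
theorem add_le_length (hx : Far T R m x) (hy : Far T R n y) (h : ¬ ReachableIn T R x y)
    (p : T.Walk x y) : m + n ≤ p.length := by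
  classical
  have : ∃ v ∈ p.support, v ∉ R := by
    by_contra! hc
    exact h ⟨p, hc⟩
  obtain ⟨v, hv, hvR⟩ := this
  have h1 := hx v hvR (p.takeUntil v hv)
  have h2 := hy v hvR (p.dropUntil v hv).reverse
  have h3 := congrArg SimpleGraph.Walk.length (p.take_spec hv)
  rw [SimpleGraph.Walk.length_append] at h3
  rw [SimpleGraph.Walk.length_reverse] at h2
  omega

/-- Let `D ⊆ R` be a set all of whose neighbours outside `D` are far or not linked to `z ∈ D`
inside `R`. Then `z` is one further. -/
theorem succ_of_separator {D : Set V} {z : V} (hDR : D ⊆ R) (hz : z ∈ D)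
    (hsep : ∀ a ∈ D, ∀ b ∉ D, T.Adj a b → Far T R n b ∨ b ∈ R ∧ ¬ ReachableIn T R z b) :
    Far T R (n + 1) z := by
  suffices h : ∀ a y, ∀ p : T.Walk a y, a ∈ D → ReachableIn T R z a → y ∉ R →
      n + 1 ≤ p.length from fun y hy p => h z y p hz (.refl (hDR hz)) hy
  intro a y p
  induction p with
  | nil => exact fun ha _ hy => absurd (hDR ha) hy
  | @cons a b y hab p ih =>
    intro ha hza hy
    rw [SimpleGraph.Walk.length_cons]
    by_cases hb : b ∈ D
    · have := ih hb (hza.trans (.of_adj hab (hDR ha) (hDR hb))) hy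
      omega
    · rcases hsep a ha b hb hab with h | ⟨hbR, h⟩
      · have := h y hy p
        omega
      · exact absurd (hza.trans (.of_adj hab (hDR ha) hbR)) h

end Far

/-! ### Vertices and cliques of snowflakes -/

variable {k : ℕ}

namespace SnowVertex

/-- The position of a vertex in the cliques that contain it. -/
def pos : SnowVertex k → Fin (k + 1)
  | base s => s
  | new _ i _ => i

/-- The height at which a vertex is introduced. -/
def height : SnowVertex k → ℕ
  | base _ => 0
  | new _ _ l => l.length + 1

@[simp]
theorem height_base (s : Fin (k + 1)) : (base s).height = 0 := rfl

@[simp]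
theorem height_new (j : Fin ((k + 1) / 2)) (i : Fin (k + 1)) (l : List (Fin (k + 1))) :
    (new j i l).height = l.length + 1 := rfl

/-- The new vertex `new j i l` together with all vertices introduced below it. -/
def descendants (j : Fin ((k + 1) / 2)) (i : Fin (k + 1)) (l : List (Fin (k + 1))) :
    Set (SnowVertex k) :=
  {x | ∃ i' l', x = new j i' l' ∧ (i :: l) <:+ (i' :: l')}

theorem self_mem_descendants (j : Fin ((k + 1) / 2)) (i : Fin (k + 1)) (l : List (Fin (k + 1))) :
    new j i l ∈ descendants j i l :=
  ⟨i, l, rfl, List.suffix_rfl⟩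

theorem base_notMem_descendants (s : Fin (k + 1)) (j : Fin ((k + 1) / 2)) (i : Fin (k + 1))
    (l : List (Fin (k + 1))) : base s ∉ descendants j i l := by
  rintro ⟨i', l', h, -⟩
  cases h

theorem descendants_subset {j : Fin ((k + 1) / 2)} {i i' : Fin (k + 1)}
    {l l' : List (Fin (k + 1))} (h : (i :: l) <:+ (i' :: l')) :
    descendants j i' l' ⊆ descendants j i l := by
  rintro x ⟨i'', l'', rfl, h'⟩
  exact ⟨i'', l'', rfl, h.trans h'⟩

theorem disjoint_descendants {j j' : Fin ((k + 1) / 2)} {i i' : Fin (k + 1)}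
    (h : (j, i) ≠ (j', i')) : Disjoint (descendants j i []) (descendants j' i' []) := by
  rw [Set.disjoint_left]
  rintro x ⟨a, l, rfl, hl⟩ ⟨b, m, hx, hm⟩
  cases hx
  refine h ?_
  have h1 := (List.suffix_of_suffix_length_le hl hm (by simp)).eq_of_length (by simp)
  simp at h1
  rw [h1]

end SnowVertex

open SnowVertex

theorem cliqueVertex_cons_self (j : Fin ((k + 1) / 2)) (i : Fin (k + 1))
    (l : List (Fin (k + 1))) : cliqueVertex j (i :: l) i = .new j i l := by
  simp [cliqueVertex]

theorem cliqueVertex_cons_of_ne (j : Fin ((k + 1) / 2)) {i s : Fin (k + 1)}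
    (l : List (Fin (k + 1))) (h : s ≠ i) : cliqueVertex j (i :: l) s = cliqueVertex j l s := by
  simp [cliqueVertex, h]

@[simp]
theorem pos_cliqueVertex (j : Fin ((k + 1) / 2)) (l : List (Fin (k + 1))) (s : Fin (k + 1)) :
    (cliqueVertex j l s).pos = s := by
  induction l with
  | nil => rfl
  | cons i l ih =>
    rcases eq_or_ne s i with rfl | h
    · rw [cliqueVertex_cons_self]; rfl
    · rw [cliqueVertex_cons_of_ne j l h, ih]

theorem cliqueVertex_injective (j : Fin ((k + 1) / 2)) (l : List (Fin (k + 1))) :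
    Function.Injective (cliqueVertex j l) := fun s t h => by
  simpa using congrArg SnowVertex.pos h

/-- A vertex of a clique is a base vertex or was introduced on the way to the clique. -/
theorem cliqueVertex_eq_or (j : Fin ((k + 1) / 2)) (l : List (Fin (k + 1))) (s : Fin (k + 1)) :
    cliqueVertex j l s = .base s ∨ ∃ l', cliqueVertex j l s = .new j s l' ∧ (s :: l') <:+ l := by
  induction l with
  | nil => exact .inl rfl
  | cons i l ih =>
    rcases eq_or_ne s i with rfl | h
    · exact .inr ⟨l, cliqueVertex_cons_self .., List.suffix_rfl⟩
    · rw [cliqueVertex_cons_of_ne j l h]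
      exact ih.imp_right fun ⟨l', h1, h2⟩ => ⟨l', h1, h2.trans (List.suffix_cons ..)⟩

theorem eq_of_cliqueVertex_eq_new {j j' : Fin ((k + 1) / 2)} {l l' : List (Fin (k + 1))}
    {s i : Fin (k + 1)} (h : cliqueVertex j l s = .new j' i l') : j = j' ∧ (i :: l') <:+ l := by
  rcases cliqueVertex_eq_or j l s with h' | ⟨m, h', hm⟩
  · rw [h'] at h; cases h
  · rw [h'] at h; cases h
    exact ⟨rfl, hm⟩

theorem height_cliqueVertex_le (j : Fin ((k + 1) / 2)) (l : List (Fin (k + 1)))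
    (s : Fin (k + 1)) : (cliqueVertex j l s).height ≤ l.length := by
  rcases cliqueVertex_eq_or j l s with h | ⟨l', h, hl⟩
  · rw [h]; exact Nat.zero_le _
  · rw [h]; exact hl.length_le

theorem occurs_cliqueVertex {h : ℕ} (j : Fin ((k + 1) / 2)) {l : List (Fin (k + 1))}
    (hl : l.IsChain (· ≠ ·)) (hlen : l.length ≤ h) (s : Fin (k + 1)) :
    (cliqueVertex j l s).Occurs h := by
  rcases cliqueVertex_eq_or j l s with h | ⟨l', h, hl'⟩
  · rw [h]; trivial
  · rw [h]; exact ⟨hl.suffix hl', hl'.length_le.trans hlen⟩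

theorem joinedTo_cliqueVertex (j : Fin ((k + 1) / 2)) (l : List (Fin (k + 1)))
    {s t : Fin (k + 1)} (hst : s ≠ t) :
    (cliqueVertex j l s).JoinedTo (cliqueVertex j l t) ∨
      (cliqueVertex j l t).JoinedTo (cliqueVertex j l s) := by
  induction l with
  | nil => exact .inl ⟨t, hst.symm, rfl⟩
  | cons i l ih =>
    rcases eq_or_ne s i with rfl | hs
    · rw [cliqueVertex_cons_self, cliqueVertex_cons_of_ne j l hst.symm]
      exact .inl ⟨t, hst.symm, rfl⟩
    · rcases eq_or_ne t i with rfl | ht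
      · rw [cliqueVertex_cons_self, cliqueVertex_cons_of_ne j l hs]
        exact .inr ⟨s, hst, rfl⟩
      · rwa [cliqueVertex_cons_of_ne j l hs, cliqueVertex_cons_of_ne j l ht]

theorem cliqueVertex_mem_descendants_or (j : Fin ((k + 1) / 2)) {i : Fin (k + 1)}
    {l m : List (Fin (k + 1))} (h : (i :: l) <:+ m) (s : Fin (k + 1)) :
    cliqueVertex j m s ∈ descendants j i l ∨ s ≠ i ∧ cliqueVertex j m s = cliqueVertex j l s := by
  induction m with
  | nil => simp at h
  | cons a m ih =>
    rcases eq_or_ne s a with rfl | hs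
    · rw [cliqueVertex_cons_self]
      exact .inl ⟨s, m, rfl, h⟩
    · rw [cliqueVertex_cons_of_ne j m hs]
      rcases List.suffix_cons_iff.1 h with h | h
      · cases h
        exact .inr ⟨hs, rfl⟩
      · exact ih h

/-- The neighbours of a set of descendants are in the clique below which they were created. -/
theorem mem_descendants_or_of_joinedTo {j : Fin ((k + 1) / 2)} {i : Fin (k + 1)}
    {l : List (Fin (k + 1))} {x y : SnowVertex k} (hx : x ∈ descendants j i l)
    (hxy : x.JoinedTo y ∨ y.JoinedTo x) :
    y ∈ descendants j i l ∨ ∃ t, t ≠ i ∧ y = cliqueVertex j l t := by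
  obtain ⟨i', l', rfl, h⟩ := hx
  rcases hxy with ⟨t, ht, rfl⟩ | hxy
  · rw [← cliqueVertex_cons_of_ne j l' ht]
    exact (cliqueVertex_mem_descendants_or j h t).imp_right fun h => ⟨t, h⟩
  · cases y with
    | base s =>
      obtain ⟨t, -, h⟩ := hxy
      cases h
    | new j' a m =>
      obtain ⟨t, ht, hm⟩ := hxy
      obtain ⟨rfl, hsuf⟩ := eq_of_cliqueVertex_eq_new hm.symm
      exact .inl ⟨a, m, rfl, h.trans (hsuf.trans (List.suffix_cons ..))⟩

/-- Except among base vertices, `JoinedTo` leads from a newer vertex to one of strictly smaller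
height. -/
theorem not_joinedTo_of_height_le {x y : SnowVertex k} (hx : 0 < x.height)
    (hxy : y.height ≤ x.height) : ¬ y.JoinedTo x := by
  intro h
  cases y with
  | base s =>
    obtain ⟨t, -, rfl⟩ := h
    exact lt_irrefl _ hx
  | new j i l =>
    obtain ⟨t, -, rfl⟩ := h
    exact absurd (hxy.trans (height_cliqueVertex_le j l t)) (Nat.not_succ_le_self _)

theorem not_joinedTo_self (x : SnowVertex k) : ¬ x.JoinedTo x := by
  cases x with
  | base s =>
    rintro ⟨t, ht, h⟩
    cases h
    exact ht rfl
  | new j i l => exact not_joinedTo_of_height_le (Nat.succ_pos _) le_rfl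

theorem snowflake_adj {h : ℕ} {v u : {v : SnowVertex k // v.Occurs h}} :
    (snowflake k h).Adj v u ↔ v.1.JoinedTo u.1 ∨ u.1.JoinedTo v.1 := by
  rw [snowflake, SimpleGraph.fromRel_adj, and_iff_right_iff_imp]
  rintro h rfl
  exact not_joinedTo_self _ (or_self_iff.1 h)

instance finite_snowVertex (k h : ℕ) : Finite {v : SnowVertex k // v.Occurs h} := by
  have : Finite {l : List (Fin (k + 1)) // l.length ≤ h} := List.finite_length_le _ _
  refine Finite.of_injective (β := Fin (k + 1) ⊕
    Fin ((k + 1) / 2) × Fin (k + 1) × {l : List (Fin (k + 1)) // l.length ≤ h})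
    (fun v => match v with
      | ⟨.base s, _⟩ => .inl s
      | ⟨.new j i l, hv⟩ => .inr (j, i, ⟨l, (Nat.le_succ _).trans hv.2⟩)) ?_
  rintro ⟨x, hx⟩ ⟨y, hy⟩ hxy
  cases x <;> cases y <;> simp_all

/-! ### Cliques of a snowflake as sets of its vertices -/

section Snowflake

variable {h : ℕ}

/-- The clique reached by `l` through the `j`-th copy, as a family of vertices of `S(k, h)`. -/
def cliqueFamily (j : Fin ((k + 1) / 2)) {l : List (Fin (k + 1))} (hl : l.IsChain (· ≠ ·))
    (hlen : l.length ≤ h) (s : Fin (k + 1)) : {v : SnowVertex k // v.Occurs h} :=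
  ⟨cliqueVertex j l s, occurs_cliqueVertex j hl hlen s⟩

theorem adj_cliqueFamily (j : Fin ((k + 1) / 2)) {l : List (Fin (k + 1))}
    (hl : l.IsChain (· ≠ ·)) (hlen : l.length ≤ h) {s t : Fin (k + 1)} (hst : s ≠ t) :
    (snowflake k h).Adj (cliqueFamily j hl hlen s) (cliqueFamily j hl hlen t) :=
  snowflake_adj.2 (joinedTo_cliqueVertex j l hst)

/-- A base vertex, as a vertex of `S(k, h)`. -/
def baseVertex (h : ℕ) (s : Fin (k + 1)) : {v : SnowVertex k // v.Occurs h} :=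
  ⟨.base s, trivial⟩

theorem baseVertex_injective : Function.Injective (baseVertex (k := k) h) := by
  intro s t hst
  have := congrArg (fun v => v.1.pos) hst
  exact this

theorem adj_baseVertex {s t : Fin (k + 1)} (hst : s ≠ t) :
    (snowflake k h).Adj (baseVertex h s) (baseVertex h t) :=
  snowflake_adj.2 (.inl ⟨t, hst.symm, rfl⟩)

theorem isNClique_image {V ι : Type*} [DecidableEq V] {G : SimpleGraph V} (f : ι → V)
    (hf : ∀ s t, s ≠ t → G.Adj (f s) (f t)) (F : Finset ι) :
    G.IsNClique F.card (F.image f) := by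
  refine ⟨?_, Finset.card_image_of_injective F fun s t hst => ?_⟩
  · intro a ha b hb hab
    obtain ⟨s, -, rfl⟩ := Finset.mem_image.1 (Finset.mem_coe.1 ha)
    obtain ⟨t, -, rfl⟩ := Finset.mem_image.1 (Finset.mem_coe.1 hb)
    exact hf s t fun h => hab (h ▸ rfl)
  · by_contra hne
    exact (hf s t hne).ne hst

/-! ### Snowflakes are `k`-trees -/

/-- The closure condition on `F` says that the parent clique of each member is present, base
vertices being present anyway. A member of maximal height can then be added last: no other vertex
present was created on top of it, so its neighbours are exactly its parent clique. -/
theorem kTreeOn_base_union (F : Finset {v : SnowVertex k // v.Occurs h})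
    (hF : ∀ v ∈ F, ∀ j i l, v.1 = .new j i l → ∀ u : {v : SnowVertex k // v.Occurs h},
      0 < u.1.height → ∀ s, u.1 = cliqueVertex j l s → u ∈ F) :
    KTreeOn k (snowflake k h) ({v | v.1.height = 0 ∨ v ∈ F}) := by
  classical
  induction F using Finset.induction_on_max_value
    (fun v : {v : SnowVertex k // v.Occurs h} => v.1.height) with
  | empty =>
    have hb := KTreeOn.base (k := k) (Finset.univ.image (baseVertex h)) (by
      simpa using isNClique_image (baseVertex h) (fun s t => adj_baseVertex) Finset.univ)
    convert hb
    ext ⟨v, hv⟩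
    cases v with
    | base s => simpa using ⟨s, rfl⟩
    | new j i l =>
      suffices ∀ s, baseVertex h s ≠ ⟨.new j i l, hv⟩ by simpa
      intro s hs
      cases congrArg Subtype.val hs
  | insert a F haF hmax ih =>
    have hF' : KTreeOn k (snowflake k h) ({v | v.1.height = 0 ∨ v ∈ F}) := by
      refine ih fun v hv j i l hvl u hu s hus => ?_
      refine (Finset.mem_insert.1
        (hF v (Finset.mem_insert_of_mem hv) j i l hvl u hu s hus)).resolve_left ?_
      rintro rfl
      have h1 := hmax v hv
      have h2 := height_cliqueVertex_le j l s
      rw [hvl, hus] at h1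
      simp only [height_new] at h1
      omega
    obtain ⟨a, ha⟩ := a
    cases a with
    | base s =>
      convert hF' using 1
      ext v
      simp only [Finset.mem_insert, Set.mem_ofPred_eq]
      constructor
      · rintro (h | rfl | h)
        exacts [.inl h, .inl rfl, .inr h]
      · tauto
    | new j i l =>
      have hst := KTreeOn.step _ hF'
        ((Finset.univ.erase i).image
          (cliqueFamily (h := h) j ha.1.tail ((Nat.le_succ _).trans ha.2)))
        (by
          intro u hu
          simp only [Finset.coe_image, Set.mem_image] at hu
          obtain ⟨s, -, rfl⟩ := hu
          rcases Nat.eq_zero_or_pos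
            (cliqueFamily (h := h) j ha.1.tail ((Nat.le_succ _).trans ha.2) s).1.height
            with h0 | h0
          · exact .inl h0
          · refine .inr ((Finset.mem_insert.1
              (hF _ (Finset.mem_insert_self _ _) j i l rfl _ h0 s rfl)).resolve_left fun he => ?_)
            have h1 := height_cliqueVertex_le j l s
            have h2 := congrArg (fun v => v.1.height) he
            simp only [cliqueFamily, List.tail_cons, height_new] at h2
            omega)
        (by
          have := isNClique_image
            (cliqueFamily (h := h) j ha.1.tail ((Nat.le_succ _).trans ha.2))
            (fun s t => adj_cliqueFamily j _ _) (Finset.univ.erase i)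
          simpa using this)
        ⟨.new j i l, ha⟩
        (by
          rintro (h | h)
          · exact Nat.succ_ne_zero _ h
          · exact haF h)
        (by
          intro v hv
          have hle : v.1.height ≤ (SnowVertex.new j i l).height := by
            rcases hv with hv | hv
            · rw [hv]; exact Nat.zero_le _
            · exact hmax v hv
          rw [snowflake_adj, or_iff_left
            (not_joinedTo_of_height_le (x := .new j i l) (Nat.succ_pos _) hle)]
          simp only [SnowVertex.JoinedTo, Finset.mem_image, Finset.mem_erase, Finset.mem_univ,
            and_true, Subtype.ext_iff, cliqueFamily]
          exact exists_congr fun t => and_congr_right fun _ => eq_comm)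
      convert hst using 1
      ext v
      simp only [Finset.mem_insert, Set.mem_ofPred_eq, Set.mem_insert_iff]
      tauto

theorem isKTree_snowflake (k h : ℕ) : IsKTree k (snowflake k h) := by
  have := Fintype.ofFinite {v : SnowVertex k // v.Occurs h}
  have hu := kTreeOn_base_union (k := k) (h := h) Finset.univ
    (fun _ _ _ _ _ _ _ _ _ _ => Finset.mem_univ _)
  rw [IsKTree]
  convert hu
  simp

end Snowflake

/-! ### The treewidth of snowflakes -/

namespace SnowVertex

/-- The clique created together with a vertex (the base clique for base vertices). -/
def clique : SnowVertex k → Fin (k + 1) → SnowVertex k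
  | base _ => base
  | new j i l => cliqueVertex j (i :: l)

/-- The vertex with which the parent of the clique of a vertex was created. -/
def parent : SnowVertex k → SnowVertex k
  | base _ => base 0
  | new _ _ [] => base 0
  | new j _ (i :: l) => new j i l

/-- The vertex with which the topmost clique containing a given vertex was created. -/
def home : SnowVertex k → SnowVertex k
  | base _ => base 0
  | new j i l => new j i l

open Classical in
/-- The depth of a vertex with respect to `parent`. -/
noncomputable def depth (v : SnowVertex k) : ℕ :=
  v.height + if v = base 0 then 0 else 1

theorem occurs_clique {h : ℕ} {v : SnowVertex k} (hv : v.Occurs h) (s : Fin (k + 1)) :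
    (v.clique s).Occurs h := by
  cases v with
  | base _ => trivial
  | new j i l => exact occurs_cliqueVertex j hv.1 hv.2 s

theorem occurs_parent {h : ℕ} {v : SnowVertex k} (hv : v.Occurs h) : v.parent.Occurs h := by
  match v, hv with
  | base _, _ => trivial
  | new _ _ [], _ => trivial
  | new _ _ (_ :: _), hv => exact ⟨hv.1.tail, (Nat.le_succ _).trans hv.2⟩

theorem occurs_home {h : ℕ} {v : SnowVertex k} (hv : v.Occurs h) : v.home.Occurs h := by
  cases v with
  | base _ => trivial
  | new j i l => exact hv

/-- Nodes of the decomposition are indexed by vertices, so the base clique is the bag of every base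
vertex. Those other than `base 0` hang as leaves at `base 0`, which is why `depth` must rank them
above it although all have height 0. -/
theorem depth_parent_lt {v : SnowVertex k} (hv : v ≠ base 0) : v.parent.depth < v.depth := by
  match v with
  | base _ => simp [depth, parent, hv]
  | new _ _ [] => simp [depth, parent]
  | new _ _ (_ :: _) => simp [depth, parent]

theorem exists_eq_clique_self (v : SnowVertex k) : ∃ s, v = v.clique s := by
  cases v with
  | base s => exact ⟨s, rfl⟩
  | new j i l => exact ⟨i, (cliqueVertex_cons_self j i l).symm⟩

theorem JoinedTo.exists_eq_clique {v u : SnowVertex k} (h : v.JoinedTo u) :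
    ∃ s, u = v.clique s := by
  cases v with
  | base s =>
    obtain ⟨t, -, rfl⟩ := h
    exact ⟨t, rfl⟩
  | new j i l =>
    obtain ⟨t, ht, rfl⟩ := h
    exact ⟨t, (cliqueVertex_cons_of_ne j l ht).symm⟩

/-- This makes the bags containing a vertex connected: moving to the parent keeps the vertex in the
bag until its `home` is reached. -/
theorem eq_home_or_exists_parent_clique (x : SnowVertex k) (s : Fin (k + 1)) :
    x = (x.clique s).home ∨ x.clique s = x.parent.clique s := by
  match x with
  | base _ => exact .inr rfl
  | new j i l =>
    rcases eq_or_ne s i with rfl | hs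
    · left
      rw [clique, cliqueVertex_cons_self]
      rfl
    · right
      rw [clique, cliqueVertex_cons_of_ne j l hs]
      cases l <;> rfl

end SnowVertex

section

variable {h : ℕ}

/-- The tree decomposition of a snowflake into the cliques of its construction. -/
noncomputable def snowflakeDecomposition (k h : ℕ) :
    TreeDecomposition (snowflake k h) {v : SnowVertex k // v.Occurs h} :=
  letI := Fintype.ofFinite {v : SnowVertex k // v.Occurs h}
  letI : DecidableEq {v : SnowVertex k // v.Occurs h} := Classical.decEq _
  let bag : {v : SnowVertex k // v.Occurs h} → Finset {v : SnowVertex k // v.Occurs h} :=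
    fun x => Finset.univ.image fun s => ⟨x.1.clique s, occurs_clique x.2 s⟩
  have mem_bag : ∀ x v, v ∈ bag x ↔ ∃ s, v.1 = x.1.clique s := by
    intro x v
    simp [bag, Subtype.ext_iff, eq_comm]
  { tree := SimpleGraph.fromRel fun x y => x ≠ baseVertex h 0 ∧ y = ⟨_, occurs_parent x.2⟩
    isTree := isTree_of_parent (fun x => ⟨_, occurs_parent x.2⟩) (fun x => x.1.depth)
      (baseVertex h 0) fun x hx => depth_parent_lt fun h => hx (Subtype.ext h)
    bag := bag
    exists_vertex_mem := fun v => ⟨v, (mem_bag _ _).2 (exists_eq_clique_self v.1)⟩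
    exists_edge_mem := by
      intro u v huv
      rcases snowflake_adj.1 huv with huv | huv
      · exact ⟨u, (mem_bag _ _).2 (exists_eq_clique_self u.1), (mem_bag _ _).2 huv.exists_eq_clique⟩
      · exact ⟨v, (mem_bag _ _).2 huv.exists_eq_clique, (mem_bag _ _).2 (exists_eq_clique_self v.1)⟩
    preconnected := by
      intro v
      set tree : SimpleGraph {v : SnowVertex k // v.Occurs h} :=
        SimpleGraph.fromRel fun x y => x ≠ baseVertex h 0 ∧ y = ⟨_, occurs_parent x.2⟩ with htree
      have key : ∀ n x, x.1.depth = n → v ∈ bag x →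
          ReachableIn tree {i | v ∈ bag i} x ⟨_, occurs_home v.2⟩ := by
        intro n
        induction n using Nat.strong_induction_on with
        | _ n ih =>
          intro x hn hx
          obtain ⟨s, hs⟩ := (mem_bag _ _).1 hx
          by_cases hxv : x = ⟨_, occurs_home v.2⟩
          · rw [← hxv]
            exact .refl hx
          · have hpar : v ∈ bag ⟨_, occurs_parent x.2⟩ := by
              rw [mem_bag]
              refine ⟨s, ?_⟩
              rcases eq_home_or_exists_parent_clique x.1 s with h | h
              · exact absurd (Subtype.ext (h.trans (congrArg SnowVertex.home hs.symm))) hxv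
              · exact hs.trans h
            have hne : x.1 ≠ .base 0 := by
              rintro h0
              apply hxv
              apply Subtype.ext
              change x.1 = v.1.home
              rw [h0, hs, h0]
              rfl
            have hlt := depth_parent_lt hne
            refine .trans (.of_adj ?_ hx hpar) (ih _ (hn ▸ hlt) _ rfl hpar)
            rw [htree, SimpleGraph.fromRel_adj]
            refine ⟨fun he => hlt.ne (congrArg (fun v => v.1.depth) he).symm,
              .inl ⟨fun he => hne (congrArg Subtype.val he), rfl⟩⟩
      exact preconnected_induce_of_reachableIn fun x hx y hy =>
        (key _ x rfl hx).trans (key _ y rfl hy).symm }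

theorem card_bag_snowflakeDecomposition_le (x : {v : SnowVertex k // v.Occurs h}) :
    ((snowflakeDecomposition k h).bag x).card ≤ k + 1 := by
  let : DecidableEq {v : SnowVertex k // v.Occurs h} := Classical.decEq _
  refine Finset.card_image_le.trans ?_
  simp

theorem treewidth_le {V ι : Type} [Fintype ι] {G : SimpleGraph V} (D : TreeDecomposition G ι)
    {n : ℕ} (hD : ∀ i, (D.bag i).card ≤ n + 1) : treewidth G ≤ n := by
  refine (iInf_le_of_le ι <| iInf_le_of_le ‹Fintype ι› <| iInf_le _ D).trans ?_
  rw [Nat.cast_le, TreeDecomposition.width, Nat.sub_le_iff_le_add]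
  exact Finset.sup_le fun i _ => hD i

theorem exists_of_treewidth_lt {V : Type} {G : SimpleGraph V} {n : ℕ} (hG : treewidth G < n) :
    ∃ (ι : Type) (D : TreeDecomposition G ι), ∀ i, (D.bag i).card ≤ n := by
  simp only [treewidth, iInf_lt_iff] at hG
  obtain ⟨ι, _, D, hD⟩ := hG
  rw [Nat.cast_lt, TreeDecomposition.width] at hD
  refine ⟨ι, D, fun i => ?_⟩
  have := Finset.le_sup (f := fun i => (D.bag i).card) (Finset.mem_univ i)
  omega

theorem treewidth_snowflake (hk : 1 ≤ k) : treewidth (snowflake k h) = k := by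
  have := Fintype.ofFinite {v : SnowVertex k // v.Occurs h}
  refine le_antisymm (treewidth_le (snowflakeDecomposition k h)
    card_bag_snowflakeDecomposition_le) ?_
  by_contra! hlt
  obtain ⟨ι, D, hD⟩ := exists_of_treewidth_lt hlt
  have : Nontrivial (Fin (k + 1)) := Fin.nontrivial_iff_two_le.2 (by omega)
  obtain ⟨i, hi⟩ := exists_card_le_bag D.isTree D.exists_edge_mem D.preconnected
    (fun s : Fin (k + 1) => {baseVertex h s})
    (by
      rintro s a rfl b rfl
      exact .refl rfl)
    (fun s t hst => by simpa using baseVertex_injective.ne hst)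
    (fun s t hst => ⟨_, rfl, _, rfl, adj_baseVertex hst⟩)
  rw [Fintype.card_fin] at hi
  have := hD i
  omega

/-! ### Connectedness of snowflakes -/

theorem reachable_baseVertex (hk : 1 ≤ k) (v : {v : SnowVertex k // v.Occurs h}) :
    (snowflake k h).Reachable v (baseVertex h 0) := by
  generalize hn : v.1.height = n
  induction n using Nat.strong_induction_on generalizing v with
  | _ n ih =>
    obtain ⟨v, hv⟩ := v
    cases v with
    | base s =>
      rcases eq_or_ne s 0 with rfl | hs
      · rfl
      · exact (adj_baseVertex hs).reachable
    | new j i l =>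
      have : Nontrivial (Fin (k + 1)) := Fin.nontrivial_iff_two_le.2 (by omega)
      obtain ⟨t, ht⟩ := exists_ne i
      have hadj : (snowflake k h).Adj ⟨_, hv⟩
          (cliqueFamily j hv.1.tail ((Nat.le_succ _).trans hv.2) t) :=
        snowflake_adj.2 (.inl ⟨t, ht, rfl⟩)
      refine hadj.reachable.trans (ih _ ?_ _ rfl)
      rw [← hn]
      exact Nat.lt_succ_of_le (height_cliqueVertex_le j l t)

theorem connected_snowflake (hk : 1 ≤ k) : (snowflake k h).Connected :=
  { preconnected := fun x y =>
      (reachable_baseVertex hk x).trans (reachable_baseVertex hk y).symm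
    nonempty := ⟨baseVertex h 0⟩ }

end

/-! ### Descending through the cliques below a child of the base clique -/

/-- `l` leads to a clique below a child of the base clique for the position `v`. -/
def IsDescent (v : Fin (k + 1)) (l : List (Fin (k + 1))) : Prop :=
  [v] <:+ l ∧ l.IsChain (· ≠ ·)

theorem isDescent_singleton (v : Fin (k + 1)) : IsDescent v [v] :=
  ⟨List.suffix_rfl, List.isChain_singleton v⟩

theorem IsDescent.cons {v i : Fin (k + 1)} {l : List (Fin (k + 1))} (hl : IsDescent v l)
    (hi : l.head? ≠ some i) : IsDescent v (i :: l) := by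
  refine ⟨hl.1.trans (List.suffix_cons ..), List.isChain_cons.2 ⟨fun y hy => ?_, hl.2⟩⟩
  rintro rfl
  exact hi hy

theorem IsDescent.exists_eq_cons {v : Fin (k + 1)} {l : List (Fin (k + 1))}
    (hl : IsDescent v l) : ∃ e m, l = e :: m := by
  cases l with
  | nil => simp [IsDescent] at hl
  | cons e m => exact ⟨e, m, rfl⟩

/-- Replace the vertices at the positions in `P` one after the other, maintaining `Q`. -/
theorem exists_refresh (j : Fin ((k + 1) / 2)) (Q : List (Fin (k + 1)) → Prop)
    (P : Finset (Fin (k + 1))) {l : List (Fin (k + 1))} (hl : Q l)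
    (hhead : ∀ i ∈ P, l.head? ≠ some i)
    (step : ∀ m i, Q m → m.length < l.length + P.card → i ∈ P → m.head? ≠ some i → Q (i :: m)) :
    ∃ l', Q l' ∧ l'.length = l.length + P.card ∧
      (∀ s ∈ P, ∃ m, Q m ∧ m.length < l.length + P.card ∧ m.head? ≠ some s ∧
        cliqueVertex j l' s = .new j s m) ∧
      (∀ s ∉ P, cliqueVertex j l' s = cliqueVertex j l s) ∧
      (l'.head? = l.head? ∨ ∃ s ∈ P, l'.head? = some s) ∧
      (P.Nonempty → ∃ s ∈ P, l'.head? = some s) := by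
  induction P using Finset.induction_on with
  | empty => exact ⟨l, hl, by simp, by simp, by simp, .inl rfl, by simp⟩
  | insert a P ha ih =>
    rw [Finset.card_insert_of_notMem ha] at step ⊢
    obtain ⟨l', hQ, hlen, hnew, hold, hh, -⟩ := ih
      (fun i hi => hhead i (Finset.mem_insert_of_mem hi))
      (fun m i hm hlt hi => step m i hm (by omega) (Finset.mem_insert_of_mem hi))
    -- The head is the original one or a position already replaced, so `a` may be replaced next.
    have hal' : l'.head? ≠ some a := by
      rcases hh with h | ⟨s, hs, h⟩
      · rw [h]
        exact hhead a (Finset.mem_insert_self ..)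
      · rw [h]
        rintro h'
        cases h'
        exact ha hs
    refine ⟨a :: l', step l' a hQ (by omega) (Finset.mem_insert_self ..) hal', ?_, ?_, ?_, ?_, ?_⟩
    · simp only [List.length_cons]
      omega
    · intro s hs
      rcases eq_or_ne s a with rfl | hsa
      · exact ⟨l', hQ, by omega, hal', cliqueVertex_cons_self ..⟩
      · obtain ⟨m, h1, h2, h3, h4⟩ := hnew s (Finset.mem_of_mem_insert_of_ne hs hsa)
        exact ⟨m, h1, by omega, h3, (cliqueVertex_cons_of_ne j l' hsa).trans h4⟩
    · intro s hs
      rw [Finset.mem_insert, not_or] at hs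
      rw [cliqueVertex_cons_of_ne j l' hs.1, hold s hs.2]
    · exact .inr ⟨a, Finset.mem_insert_self .., rfl⟩
    · exact fun _ => ⟨a, Finset.mem_insert_self .., rfl⟩

theorem exists_ne_ne (hk : 2 ≤ k) (a b : Fin (k + 1)) : ∃ s, s ≠ a ∧ s ≠ b := by
  have h : (Finset.univ \ {a, b} : Finset (Fin (k + 1))).Nonempty := by
    rw [← Finset.card_pos]
    have := Finset.le_card_sdiff {a, b} (Finset.univ : Finset (Fin (k + 1)))
    have := Finset.card_le_two (a := a) (b := b)
    simp only [Finset.card_univ, Fintype.card_fin] at *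
    omega
  obtain ⟨s, hs⟩ := h
  exact ⟨s, by simpa using hs⟩

theorem card_univ_sdiff_pair {a b : Fin (k + 1)} (hab : a ≠ b) :
    (Finset.univ \ {a, b} : Finset (Fin (k + 1))).card = k - 1 := by
  rw [Finset.card_sdiff_of_subset (Finset.subset_univ _), Finset.card_pair hab]
  simp

section Descent

variable {T : SimpleGraph (SnowVertex k)} {R : Set (SnowVertex k)} {j : Fin ((k + 1) / 2)}
  {v : Fin (k + 1)} {h c N p q n : ℕ} {l : List (Fin (k + 1))} {a b : Fin (k + 1)}

/-- A subgraph `T` of the snowflake in which vertices of a common clique below a child of the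
base clique have distance at most `c + 1`, and a set `R` that contains all vertices below. -/
structure IsSpannerBelow (T : SimpleGraph (SnowVertex k)) (R : Set (SnowVertex k))
    (j : Fin ((k + 1) / 2)) (v : Fin (k + 1)) (h c : ℕ) : Prop where
  two_le : 2 ≤ k
  joinedTo : ∀ x y, T.Adj x y → x.JoinedTo y ∨ y.JoinedTo x
  subset : descendants j v [] ⊆ R
  exists_walk : ∀ l, IsDescent v l → l.length ≤ h → ∀ s t,
    ∃ w : T.Walk (cliqueVertex j l s) (cliqueVertex j l t), w.length ≤ c + 1

variable (T R j v) in
/-- All vertices of the clique reached by `l` have distance at least `p` to the outside of `R`,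
and they are not all linked inside `R`. -/
structure IsSplit (p : ℕ) (l : List (Fin (k + 1))) : Prop where
  isDescent : IsDescent v l
  far : ∀ s, Far T R p (cliqueVertex j l s)
  exists_not : ∃ s t, ¬ ReachableIn T R (cliqueVertex j l s) (cliqueVertex j l t)

variable (T R j v) in
/-- The vertex at position `b` of the clique reached by `l` has distance at least `p` to the
outside of `R`, the other vertices have distance at least `q`, and they are not linked to it
inside `R`. -/
structure IsIsolated (p q : ℕ) (b : Fin (k + 1)) (l : List (Fin (k + 1))) : Prop where
  isDescent : IsDescent v l
  head : l.head? ≠ some b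
  far_self : Far T R p (cliqueVertex j l b)
  far : ∀ s, s ≠ b → Far T R q (cliqueVertex j l s)
  not_reachable : ∀ s, s ≠ b → ¬ ReachableIn T R (cliqueVertex j l s) (cliqueVertex j l b)

namespace IsSpannerBelow

/-- A walk leaving the descendants of the new vertex passes through the rest of its clique. Clique
vertices not linked to it inside `R` cannot be the first exit, so their distance to the outside is
irrelevant. -/
theorem far_new (H : IsSpannerBelow T R j v h c) {e : Fin (k + 1)} (hl : [v] <:+ (e :: l))
    (hfar : ∀ t, t ≠ e → Far T R n (cliqueVertex j l t) ∨
      cliqueVertex j l t ∈ R ∧ ¬ ReachableIn T R (.new j e l) (cliqueVertex j l t)) :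
    Far T R (n + 1) (.new j e l) := by
  refine Far.succ_of_separator (D := descendants j e l)
    ((descendants_subset hl).trans H.subset) (self_mem_descendants ..) fun x hx y hy hxy => ?_
  rcases mem_descendants_or_of_joinedTo hx (H.joinedTo x y hxy) with h | ⟨t, ht, rfl⟩
  exacts [absurd h hy, hfar t ht]

/-- The most recent vertex has distance `p + 1` to the outside and is unlinked to some vertex of the
clique, so a detour gives `(p + 1) + p ≤ c + 1`. -/
theorem two_mul_le_of_isSplit (H : IsSpannerBelow T R j v h c)
    (hl : IsSplit T R j v p l) (hlen : l.length ≤ h) : 2 * p ≤ c := by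
  obtain ⟨e, m, rfl⟩ := hl.isDescent.exists_eq_cons
  have he : Far T R (p + 1) (cliqueVertex j (e :: m) e) := by
    rw [cliqueVertex_cons_self]
    refine H.far_new hl.isDescent.1 fun t ht => .inl ?_
    rw [← cliqueVertex_cons_of_ne j m ht]
    exact hl.far t
  obtain ⟨s, t, hst⟩ := hl.exists_not
  have key : ∀ s, ¬ ReachableIn T R (cliqueVertex j (e :: m) e) (cliqueVertex j (e :: m) s) →
      2 * p ≤ c := by
    intro s hs
    obtain ⟨w, hw⟩ := H.exists_walk _ hl.isDescent hlen e s
    have := he.add_le_length (hl.far s) hs w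
    omega
  exact (ReachableIn.not_or_not hst _).elim (key s) (key t)

/-- The most recent vertex cannot escape through `b`, so it has distance `q + 1`, and its detour to
`b` gives `(q + 1) + p ≤ c + 1`. -/
theorem add_le_of_isIsolated (H : IsSpannerBelow T R j v h c) (hp : 1 ≤ p)
    (hl : IsIsolated T R j v p q b l) (hlen : l.length ≤ h) : q + p ≤ c := by
  obtain ⟨e, m, rfl⟩ := hl.isDescent.exists_eq_cons
  have heb : e ≠ b := by
    rintro rfl
    exact hl.head rfl
  have he : Far T R (q + 1) (cliqueVertex j (e :: m) e) := by
    rw [cliqueVertex_cons_self]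
    refine H.far_new hl.isDescent.1 fun t ht => ?_
    rw [← cliqueVertex_cons_of_ne j m ht, ← cliqueVertex_cons_self]
    rcases eq_or_ne t b with rfl | htb
    · exact .inr ⟨hl.far_self.mem hp, hl.not_reachable e heb⟩
    · exact .inl (hl.far t htb)
  obtain ⟨w, hw⟩ := H.exists_walk _ hl.isDescent hlen e b
  have := he.add_le_length hl.far_self (hl.not_reachable e heb) w
  omega

/-- If no further split clique occurs, then far vertices of a clique are linked. -/
theorem reachableIn_of_far (H : IsSpannerBelow T R j v h c)
    (hno : ∀ m, m.length ≤ N → ¬ IsSplit T R j v (p + 1) m) (hl : IsDescent v l)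
    (hb : l.head? ≠ some b) (hlen : l.length + 1 ≤ N)
    (hfar : ∀ s, s ≠ b → Far T R (p + 1) (cliqueVertex j l s)) {s t : Fin (k + 1)}
    (hs : s ≠ b) (ht : t ≠ b) :
    ReachableIn T R (cliqueVertex j l s) (cliqueVertex j l t) := by
  by_contra hst
  -- Otherwise the child replacing `b` would be split at distance `p + 1`: it keeps the unlinked
  -- pair and loses the only vertex that may be near.
  refine hno (b :: l) hlen ⟨hl.cons hb, fun r => ?_, s, t, ?_⟩
  · rcases eq_or_ne r b with rfl | hr
    · rw [cliqueVertex_cons_self]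
      exact (H.far_new (hl.cons hb).1 fun t ht => .inl (hfar t ht)).mono (Nat.le_succ _)
    · rw [cliqueVertex_cons_of_ne j l hr]
      exact hfar r hr
  · rwa [cliqueVertex_cons_of_ne j l hs, cliqueVertex_cons_of_ne j l ht]

theorem isIsolated_cons (H : IsSpannerBelow T R j v h c) (hp : 1 ≤ p) (hpq : p + 1 ≤ q)
    (hno : ∀ m, m.length ≤ N → ¬ IsSplit T R j v (p + 1) m)
    (hl : IsIsolated T R j v p q b l) (hab : a ≠ b) (ha : l.head? ≠ some a)
    (hlen : l.length + 2 ≤ N) :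
    IsIsolated T R j v p q b (a :: l) ∧ Far T R (q + 1) (.new j a l) := by
  have hd := hl.isDescent.cons ha
  have hab' : (a :: l).head? ≠ some b := by simpa using hab
  have hfar : Far T R (p + 1) (.new j a l) := by
    refine H.far_new hd.1 fun t _ => .inl ?_
    rcases eq_or_ne t b with rfl | htb
    · exact hl.far_self
    · exact (hl.far t htb).mono (by omega)
  have hlink := fun s (hs : s ≠ b) t (ht : t ≠ b) =>
    H.reachableIn_of_far hno hd hab' (by simp only [List.length_cons]; omega) (fun s hs => by
      rcases eq_or_ne s a with rfl | hsa
      · rwa [cliqueVertex_cons_self]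
      · rw [cliqueVertex_cons_of_ne j l hsa]
        exact (hl.far s hs).mono hpq) hs ht
  -- A third vertex `r` survives the replacement of `a`. It is linked to all vertices but `b`, so if
  -- any of these were linked to `b`, so would `r` be.
  obtain ⟨r, hra, hrb⟩ := exists_ne_ne H.two_le a b
  have hnot : ∀ s, s ≠ b → ¬ ReachableIn T R (cliqueVertex j (a :: l) s)
      (cliqueVertex j (a :: l) b) := by
    intro s hs hsb
    refine hl.not_reachable r hrb ?_
    have := (hlink r hrb s hs).trans hsb
    rwa [cliqueVertex_cons_of_ne j l hra, cliqueVertex_cons_of_ne j l hab.symm] at this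
  have hfar' : Far T R (q + 1) (.new j a l) := by
    refine H.far_new hd.1 fun t ht => ?_
    rcases eq_or_ne t b with rfl | htb
    · have := hnot a hab
      rw [cliqueVertex_cons_self, cliqueVertex_cons_of_ne j l ht] at this
      exact .inr ⟨hl.far_self.mem hp, this⟩
    · exact .inl (hl.far t htb)
  refine ⟨⟨hd, hab', ?_, fun s hs => ?_, hnot⟩, hfar'⟩
  · rw [cliqueVertex_cons_of_ne j l hab.symm]
    exact hl.far_self
  · rcases eq_or_ne s a with rfl | hsa
    · rw [cliqueVertex_cons_self]
      exact hfar'.mono (Nat.le_succ _)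
    · rw [cliqueVertex_cons_of_ne j l hsa]
      exact hl.far s hs

theorem exists_isIsolated_succ (H : IsSpannerBelow T R j v h c) (hp : 1 ≤ p) (hpq : p + 1 ≤ q)
    (hno : ∀ m, m.length ≤ N → ¬ IsSplit T R j v (p + 1) m)
    (hl : IsIsolated T R j v p q b l) (hlen : l.length + k + 1 ≤ N) :
    ∃ l', IsIsolated T R j v p (q + 1) b l' ∧ l'.length = l.length + k := by
  have hk := H.two_le
  obtain ⟨e, m, rfl⟩ := hl.isDescent.exists_eq_cons
  have heb : e ≠ b := by
    rintro rfl
    exact hl.head rfl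
  have hP := card_univ_sdiff_pair heb
  obtain ⟨l', hl', hlen', hnew, -, -, hhead⟩ := exists_refresh j (IsIsolated T R j v p q b)
    (Finset.univ \ {e, b}) hl
    (fun i hi => by
      have : i ≠ e ∧ i ≠ b := by simpa using hi
      simpa using this.1.symm)
    (fun m i hm hlt hi hmi => by
      have : i ≠ e ∧ i ≠ b := by simpa using hi
      exact (H.isIsolated_cons hp hpq hno hm this.2 hmi (by omega)).1)
  obtain ⟨s, hs, hsh⟩ := hhead (Finset.card_pos.1 (by omega))
  have hse : l'.head? ≠ some e := by
    rw [hsh]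
    simp only [Finset.mem_sdiff, Finset.mem_univ, Finset.mem_insert, Finset.mem_singleton,
      true_and, not_or] at hs
    simpa using hs.1
  -- The position `e` was the head at the start, so it could not be replaced first and is replaced
  -- last.
  obtain ⟨h1, h2⟩ := H.isIsolated_cons hp hpq hno hl' heb hse (by omega)
  refine ⟨e :: l', ⟨h1.isDescent, h1.head, h1.far_self, fun s hs => ?_, h1.not_reachable⟩, ?_⟩
  · rcases eq_or_ne s e with rfl | hse
    · rwa [cliqueVertex_cons_self]
    · rw [cliqueVertex_cons_of_ne j l' hse]
      obtain ⟨m', hm', hlt, hm'', h⟩ := hnew s (by simp [hs, hse])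
      rw [h]
      exact (H.isIsolated_cons hp hpq hno hm' hs hm'' (by omega)).2
  · simp only [List.length_cons] at hlen' ⊢
    omega

/-- Here `n` counts the rounds of `k` replacements. Each raises `q` by one, and once `q` reaches
`c`, the bound `q + p ≤ c` fails because `p` is positive. -/
theorem not_isIsolated (H : IsSpannerBelow T R j v h c) (hp : 1 ≤ p)
    (hno : ∀ m, m.length ≤ N → ¬ IsSplit T R j v (p + 1) m) (hN : N ≤ h) (n : ℕ) :
    ∀ q l, p + 1 ≤ q → c ≤ q + n → l.length + n * k + 1 ≤ N →
      ¬ IsIsolated T R j v p q b l := by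
  induction n with
  | zero =>
    intro q l hpq hq hlen hl
    have := H.add_le_of_isIsolated hp hl (by omega)
    omega
  | succ n ih =>
    intro q l hpq hq hlen hl
    rw [Nat.succ_mul] at hlen
    obtain ⟨l', hl', hlen'⟩ := H.exists_isIsolated_succ hp hpq hno hl (by omega)
    exact ih (q + 1) l' (by omega) (by omega) (by omega) hl'

/-- After replacing `a`, only `b` may be nearer than `p + 1`. The other vertices are then mutually
linked, and as `s` is not linked to `b`, none is: `b` is isolated with `q = p + 1`. -/
theorem false_of_not_reachableIn (H : IsSpannerBelow T R j v h c) (hp : 1 ≤ p)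
    (hno : ∀ m, m.length ≤ N → ¬ IsSplit T R j v (p + 1) m) (hN : N ≤ h)
    (hlen : l.length + 1 + (c - (p + 1)) * k + 1 ≤ N) (hl : IsDescent v l)
    (ha : l.head? ≠ some a) (hab : a ≠ b) (hfar : ∀ s, Far T R p (cliqueVertex j l s))
    (hfar' : ∀ s, s ≠ a → s ≠ b → Far T R (p + 1) (cliqueVertex j l s)) {s : Fin (k + 1)}
    (hsa : s ≠ a) (hsb : s ≠ b)
    (hs : ¬ ReachableIn T R (cliqueVertex j l s) (cliqueVertex j l b)) : False := by
  have hd := hl.cons ha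
  have hab' : (a :: l).head? ≠ some b := by simpa using hab
  have hF : ∀ s, s ≠ b → Far T R (p + 1) (cliqueVertex j (a :: l) s) := by
    intro s hs
    rcases eq_or_ne s a with rfl | hsa
    · rw [cliqueVertex_cons_self]
      exact H.far_new hd.1 fun t _ => .inl (hfar t)
    · rw [cliqueVertex_cons_of_ne j l hsa]
      exact hfar' s hsa hs
  refine H.not_isIsolated hp hno hN (c - (p + 1)) (p + 1) (a :: l) le_rfl (by omega)
    (by simpa using hlen) (b := b) ⟨hd, hab', ?_, hF, fun t ht htb => hs ?_⟩
  · rw [cliqueVertex_cons_of_ne j l hab.symm]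
    exact hfar b
  · have := (H.reachableIn_of_far hno hd hab' (by simp only [List.length_cons]; omega) hF hsb
      ht).trans htb
    rwa [cliqueVertex_cons_of_ne j l hsa, cliqueVertex_cons_of_ne j l hab.symm] at this

/-- Below a split clique there is a split clique that is one further from the outside. -/
theorem exists_isSplit_succ (H : IsSpannerBelow T R j v h c) (hp : 1 ≤ p)
    (hl : IsSplit T R j v p l) (hlen : l.length + c * k ≤ h) :
    ∃ l', l'.length ≤ l.length + c * k ∧ IsSplit T R j v (p + 1) l' := by
  have hk := H.two_le
  have hpc := H.two_mul_le_of_isSplit hl (by omega)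
  by_contra! hno
  obtain ⟨a, m, rfl⟩ := hl.isDescent.exists_eq_cons
  obtain ⟨b, hab⟩ : ∃ b, ¬ ReachableIn T R (cliqueVertex j (a :: m) a)
      (cliqueVertex j (a :: m) b) := by
    obtain ⟨s, t, hst⟩ := hl.exists_not
    exact (ReachableIn.not_or_not hst _).elim (fun h => ⟨s, h⟩) (fun h => ⟨t, h⟩)
  have hne : a ≠ b := by
    rintro rfl
    exact hab (.refl ((hl.far a).mem hp))
  have hP := card_univ_sdiff_pair hne
  have hmem : ∀ i, i ∈ (Finset.univ \ {a, b} : Finset (Fin (k + 1))) ↔ i ≠ a ∧ i ≠ b := by simp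
  obtain ⟨l', ⟨hd, hfar⟩, hlen', hnew, hold, -, hhead⟩ := exists_refresh j
    (fun l => IsDescent v l ∧ ∀ s, Far T R p (cliqueVertex j l s))
    (Finset.univ \ {a, b}) ⟨hl.isDescent, hl.far⟩
    (fun i hi => by simpa using ((hmem i).1 hi).1.symm)
    (fun m i ⟨hm, hfar⟩ _ _ hmi => by
      refine ⟨hm.cons hmi, fun s => ?_⟩
      rcases eq_or_ne s i with rfl | hs
      · rw [cliqueVertex_cons_self]
        exact (H.far_new (hm.cons hmi).1 fun t _ => .inl (hfar t)).mono (Nat.le_succ p)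
      · rw [cliqueVertex_cons_of_ne j m hs]
        exact hfar s)
  obtain ⟨s, hs, hsh⟩ := hhead (Finset.card_pos.1 (by omega))
  obtain ⟨hsa, hsb⟩ := (hmem s).1 hs
  have hfar' : ∀ s, s ≠ a → s ≠ b → Far T R (p + 1) (cliqueVertex j l' s) := by
    intro s hsa hsb
    obtain ⟨m', ⟨hm, hmfar⟩, -, hms, h⟩ := hnew s ((hmem s).2 ⟨hsa, hsb⟩)
    rw [h]
    exact H.far_new (hm.cons hms).1 fun t _ => .inl (hmfar t)
  -- The `k - 1` replacements already made, the two spare ones and `c - (p + 1)` rounds of `k` fit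
  -- into `c * k` because `k + 1 ≤ (p + 1) * k`.
  have hlen'' : l'.length + 1 + (c - (p + 1)) * k + 1 ≤ (a :: m).length + c * k := by
    obtain ⟨d, rfl⟩ : ∃ d, c = d + (p + 1) := ⟨c - (p + 1), by omega⟩
    have : 2 * k ≤ (p + 1) * k := Nat.mul_le_mul_right k (by omega)
    rw [Nat.add_sub_cancel, Nat.add_mul]
    omega
  rw [← hold a (by simp), ← hold b (by simp)] at hab
  -- A third vertex `s` is unlinked to `a` or to `b`; that one becomes the isolated vertex and the
  -- other is replaced.
  rcases ReachableIn.not_or_not hab (cliqueVertex j l' s) with h | h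
  · exact H.false_of_not_reachableIn hp hno hlen hlen'' hd (by rw [hsh]; simpa using hsb)
      hne.symm hfar (fun s h1 h2 => hfar' s h2 h1) hsb hsa h
  · exact H.false_of_not_reachableIn hp hno hlen hlen'' hd (by rw [hsh]; simpa using hsa)
      hne hfar hfar' hsa hsb h

theorem not_isSplit_one (H : IsSpannerBelow T R j v (k * c ^ 2) c) (hc : 1 ≤ c)
    (hlen : l.length ≤ k) : ¬ IsSplit T R j v 1 l := by
  intro hl
  have bound : ∀ p, 2 * p ≤ c → k + p * (c * k) ≤ k * c ^ 2 := by
    intro p hp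
    have : 1 + p * c ≤ c ^ 2 := by
      rcases Nat.eq_zero_or_pos p with rfl | hp0
      · simpa using Nat.one_le_pow 2 c hc
      · nlinarith
    calc k + p * (c * k) = k * (1 + p * c) := by ring
      _ ≤ k * c ^ 2 := Nat.mul_le_mul_left k this
  have key : ∀ p, 2 * p ≤ c → ∃ l', l'.length ≤ k + p * (c * k) ∧
      IsSplit T R j v (p + 1) l' := by
    intro p
    induction p with
    | zero => exact fun _ => ⟨l, by simpa using hlen, hl⟩
    | succ p ih =>
      intro hp
      obtain ⟨l', h1, h2⟩ := ih (by omega)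
      have hb := bound (p + 1) hp
      rw [Nat.succ_mul] at hb ⊢
      obtain ⟨l'', h3, h4⟩ := H.exists_isSplit_succ (by omega) h2 (by omega)
      exact ⟨l'', by omega, h4⟩
  -- The clique found is split at distance `c / 2 + 1`, and twice that exceeds `c`.
  obtain ⟨l', h1, h2⟩ := key (c / 2) (by omega)
  have := H.two_mul_le_of_isSplit h2 (h1.trans (bound _ (by omega)))
  omega

end IsSpannerBelow

/-- A base vertex `u` and the new vertex of a child of the base clique that keeps `u` are linked
by vertices below that child. -/
theorem IsSpannerBelow.reachableIn {u : Fin (k + 1)}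
    (H : IsSpannerBelow T (insert (.base u) (descendants j v [])) j v (k * c ^ 2) c)
    (hc : 1 ≤ c) (huv : u ≠ v) :
    ReachableIn T (insert (.base u) (descendants j v [])) (.new j v []) (.base u) := by
  by_contra hnot
  have hk := H.two_le
  have hmem : ∀ i, i ∈ (Finset.univ \ {u, v} : Finset (Fin (k + 1))) ↔ i ≠ u ∧ i ≠ v := by simp
  have hP := card_univ_sdiff_pair huv
  -- Replacing the other `k - 1` positions brings the whole clique into `R` while keeping the
  -- unlinked pair. This yields a split clique with `p = 1` at height `k`.
  obtain ⟨l, hd, hlen, hnew, hold, -, -⟩ := exists_refresh j (IsDescent v)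
    (Finset.univ \ {u, v}) (isDescent_singleton v)
    (fun i hi => by simpa using ((hmem i).1 hi).2.symm)
    (fun m i hm _ _ hmi => hm.cons hmi)
  have hu : cliqueVertex j l u = .base u := by
    rw [hold u (by simp), cliqueVertex_cons_of_ne j [] huv]
    rfl
  have hv : cliqueVertex j l v = .new j v [] := by
    rw [hold v (by simp), cliqueVertex_cons_self]
  rw [List.length_singleton] at hlen
  refine H.not_isSplit_one hc (l := l) (by omega) ⟨hd, fun s => Far.one_of_mem ?_, v, u, ?_⟩
  · rcases eq_or_ne s u with rfl | hsu
    · rw [hu]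
      exact Set.mem_insert ..
    · right
      rcases eq_or_ne s v with rfl | hsv
      · rw [hv]
        exact self_mem_descendants ..
      · obtain ⟨m, hm, -, hms, h⟩ := hnew s ((hmem s).2 ⟨hsu, hsv⟩)
        rw [h]
        exact ⟨s, m, rfl, (hm.cons hms).1⟩
  · rwa [hu, hv]

end Descent

/-! ### A complete minor at the base clique -/

section BaseMinor

open scoped Fin.CommRing

variable {T : SimpleGraph (SnowVertex k)}

theorem ReachableIn.reachableIn_setOf {V : Type*} {G : SimpleGraph V} {R : Set V} {x y : V}
    (h : ReachableIn G R x y) : ReachableIn G {z | ReachableIn G R x z} x y := by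
  classical
  obtain ⟨p, hp⟩ := h
  exact ⟨p, fun v hv =>
    ⟨p.takeUntil v hv, fun w hw => hp w (p.support_takeUntil_subset_support hv hw)⟩⟩

/-- The walk is cut just before its first visit to `b`. This yields the edges between branch sets.
-/
theorem ReachableIn.exists_adj_of_insert {V : Type*} {G : SimpleGraph V} {R : Set V} {a b : V}
    (h : ReachableIn G (insert b R) a b) (hab : a ≠ b) : ∃ x, ReachableIn G R a x ∧ G.Adj x b := by
  obtain ⟨p, hp⟩ := h
  induction p with
  | nil => exact absurd rfl hab
  | @cons a a' b hadj p ih =>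
    have ha : a ∈ R := (hp a (by simp)).resolve_left hab
    by_cases hb : a' = b
    · subst hb
      exact ⟨a, .refl ha, hadj⟩
    · obtain ⟨x, hx, hxb⟩ := ih hb fun v hv => hp v (by simp [hv])
      exact ⟨x, .trans (.of_adj hadj ha hx.left_mem) hx, hxb⟩

/-- The position `j + 1` steps after `s`, in cyclic order. -/
def shift (s : Fin (k + 1)) (j : Fin ((k + 1) / 2)) : Fin (k + 1) :=
  s + ((j + 1 : ℕ) : Fin (k + 1))

/-- The pair `s`, `shift s j` uses the `j`-th child for the position `shift s j + 1`; by injectivity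
different `s` use different children. -/
theorem shift_injective (j : Fin ((k + 1) / 2)) :
    Function.Injective fun s : Fin (k + 1) => shift s j + 1 := fun s t h => by
  simpa [shift] using h

/-- The child assigned to a pair keeps both of its vertices: the offset `j + 2` is at most `k`,
hence nonzero modulo `k + 1`. -/
theorem shift_add_one_ne (hk : 3 ≤ k) (s : Fin (k + 1)) (j : Fin ((k + 1) / 2)) :
    s ≠ shift s j + 1 ∧ shift s j ≠ shift s j + 1 := by
  have h : ∀ n : ℕ, 0 < n → n < k + 1 → ((n : ℕ) : Fin (k + 1)) ≠ 0 := fun n h0 hn h =>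
    (Nat.le_of_dvd h0 (Fin.natCast_eq_zero.1 h)).not_gt hn
  constructor
  · have := h (j + 1 + 1) (by omega) (by omega)
    intro he
    rw [shift, add_assoc, left_eq_add] at he
    exact this (by exact_mod_cast he)
  · have := h 1 (by omega) (by omega)
    intro he
    rw [left_eq_add] at he
    exact this (by exact_mod_cast he)

/-- One of the two cyclic distances between `s` and `t` is at most `(k + 1) / 2`. -/
theorem exists_shift_eq {s t : Fin (k + 1)} (hst : s ≠ t) :
    (∃ j, shift s j = t) ∨ ∃ j, shift t j = s := by
  have key : ∀ s t : Fin (k + 1), s ≠ t → (t - s).val ≤ (k + 1) / 2 → ∃ j, shift s j = t := by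
    intro s t hst h
    have h0 : (t - s).val ≠ 0 := fun h0 => hst (sub_eq_zero.1 (Fin.ext h0)).symm
    refine ⟨⟨(t - s).val - 1, by omega⟩, ?_⟩
    rw [shift]
    simp only [Nat.sub_add_cancel (Nat.one_le_iff_ne_zero.2 h0)]
    rw [Fin.cast_val_eq_self]
    abel
  rcases le_or_gt (t - s).val ((k + 1) / 2) with h | h
  · exact .inl (key s t hst h)
  · refine .inr (key t s hst.symm ?_)
    have h0 : t - s ≠ 0 := sub_ne_zero.2 hst.symm
    rw [← neg_sub, Fin.val_neg, if_neg h0]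
    omega

/-- If base vertices are linked below suitable distinct children of the base clique, then they
are contained in the branch sets of a complete minor. -/
theorem exists_card_le_bag_of_reachableIn {ι : Type*} {tree : SimpleGraph ι}
    {bag : ι → Finset (SnowVertex k)} (hk : 3 ≤ k) (htree : tree.IsTree)
    (hedge : ∀ u v, T.Adj u v → ∃ i, u ∈ bag i ∧ v ∈ bag i)
    (hconn : ∀ v, (tree.induce {i | v ∈ bag i}).Preconnected)
    (hlink : ∀ j s, ReachableIn T
      (insert (.base (shift s j)) (insert (.base s) (descendants j (shift s j + 1) [])))
      (.base s) (.base (shift s j))) :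
    ∃ i, k + 1 ≤ (bag i).card := by
  have : Nontrivial (Fin (k + 1)) := Fin.nontrivial_iff_two_le.2 (by omega)
  let R : Fin (k + 1) → Fin ((k + 1) / 2) → Set (SnowVertex k) := fun s j =>
    insert (.base s) (descendants j (shift s j + 1) [])
  -- The branch set of `s` collects what is linked to `s` below the children assigned to `s`; it
  -- contains no other base vertex.
  let A : Fin (k + 1) → Set (SnowVertex k) := fun s =>
    {x | ∃ j, ReachableIn T (R s j) (.base s) x}
  have hbase : ∀ s x, x ∈ A s → ReachableIn T (A s) (.base s) x := by
    rintro s x ⟨j, hx⟩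
    exact hx.reachableIn_setOf.mono fun z hz => ⟨j, hz⟩
  have hadj : ∀ s j, ∃ a ∈ A s, ∃ b ∈ A (shift s j), T.Adj a b := by
    intro s j
    have hne : s ≠ shift s j := by
      intro h
      rw [shift, left_eq_add, Fin.natCast_eq_zero] at h
      have := Nat.le_of_dvd (by omega) h
      omega
    obtain ⟨x, hx, hxb⟩ := (hlink j s).exists_adj_of_insert (by simpa using hne)
    exact ⟨x, ⟨j, hx⟩, _, ⟨j, .refl (Set.mem_insert ..)⟩, hxb⟩
  have h := exists_card_le_bag (κ := Fin (k + 1)) htree hedge hconn A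
    (fun s a ha b hb => (hbase s a ha).symm.trans (hbase s b hb))
    (by
      intro s t hst
      rw [Set.disjoint_left]
      rintro x ⟨j, hx⟩ ⟨j', hx'⟩
      rcases hx.right_mem with rfl | hx <;> rcases hx'.right_mem with hx' | hx'
      · cases hx'
        exact hst rfl
      · exact base_notMem_descendants _ _ _ _ hx'
      · rw [hx'] at hx
        exact base_notMem_descendants _ _ _ _ hx
      · refine Set.disjoint_left.1 (disjoint_descendants fun he => ?_) hx hx'
        obtain ⟨rfl, he⟩ := Prod.mk.inj he
        exact hst (shift_injective j he))
    (by
      intro s t hst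
      rcases exists_shift_eq hst with ⟨j, rfl⟩ | ⟨j, rfl⟩
      · exact hadj s j
      · obtain ⟨a, ha, b, hb, hab⟩ := hadj t j
        exact ⟨b, hb, a, ha, hab.symm⟩)
  simpa using h

end BaseMinor

/-! ### Spanners of snowflakes -/

section Spanner

variable {h c : ℕ} {T : SimpleGraph {v : SnowVertex k // v.Occurs h}}

theorem exists_walk_of_isAdditiveSpanner {V : Type*} {T G : SimpleGraph V}
    (hT : IsAdditiveSpanner c T G) {x y : V} (hxy : x = y ∨ G.Adj x y) :
    ∃ w : T.Walk x y, w.length ≤ c + 1 := by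
  have h1 : T.edist x y ≤ ((c + 1 : ℕ) : ℕ∞) := by
    refine (hT.2 x y).trans ?_
    have : G.edist x y ≤ 1 := SimpleGraph.edist_le_one_iff_adj_or_eq.2 hxy.symm
    rw [Nat.cast_add, add_comm (c : ℕ∞)]
    exact add_le_add_left this _
  obtain ⟨w, hw⟩ := SimpleGraph.exists_walk_of_edist_ne_top
    (ne_top_of_le_ne_top (ENat.natCast_ne_top _) h1)
  rw [← hw, Nat.cast_le] at h1
  exact ⟨w, h1⟩

/-- Viewing `T` on all names only adds isolated vertices and spares the height bound in sets such as
`descendants`. -/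
theorem isSpannerBelow_map (hk : 2 ≤ k) (hT : IsAdditiveSpanner c T (snowflake k h))
    {j : Fin ((k + 1) / 2)} {v : Fin (k + 1)} {R : Set (SnowVertex k)}
    (hR : descendants j v [] ⊆ R) :
    IsSpannerBelow (T.map (Function.Embedding.subtype _)) R j v h c where
  two_le := hk
  joinedTo := by
    intro x y hxy
    rw [SimpleGraph.map_adj] at hxy
    obtain ⟨x, y, hxy, rfl, rfl⟩ := hxy
    exact snowflake_adj.1 (hT.1 hxy)
  subset := hR
  exists_walk := by
    intro l hl hlen s t
    obtain ⟨w, hw⟩ := exists_walk_of_isAdditiveSpanner hT (x := cliqueFamily j hl.2 hlen s)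
      (y := cliqueFamily j hl.2 hlen t) (by
        rcases eq_or_ne s t with rfl | hst
        exacts [.inl rfl, .inr (adj_cliqueFamily j _ _ hst)])
    exact ⟨w.map (SimpleGraph.Embedding.map (Function.Embedding.subtype _) T).toHom,
      (SimpleGraph.Walk.length_map ..).trans_le hw⟩

theorem not_treewidth_le_of_isAdditiveSpanner (hk : 3 ≤ k) (hc : 1 ≤ c)
    {T : SimpleGraph {v : SnowVertex k // v.Occurs (k * c ^ 2)}}
    (hT : IsAdditiveSpanner c T (snowflake k (k * c ^ 2))) :
    ¬ treewidth T ≤ ((k - 1 : ℕ) : ℕ∞) := by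
  intro htw
  obtain ⟨ι, D, hD⟩ := exists_of_treewidth_lt
    (htw.trans_lt (Nat.cast_lt.2 (Nat.sub_lt (by omega : 0 < k) one_pos)))
  obtain ⟨i, hi⟩ := exists_card_le_bag_of_reachableIn
    (T := T.map (Function.Embedding.subtype _))
    (bag := fun i => (D.bag i).map (Function.Embedding.subtype _)) hk D.isTree
    (by
      intro u v huv
      rw [SimpleGraph.map_adj] at huv
      obtain ⟨u, v, huv, rfl, rfl⟩ := huv
      obtain ⟨i, hu, hv⟩ := D.exists_edge_mem u v huv
      exact ⟨i, Finset.mem_map_of_mem _ hu, Finset.mem_map_of_mem _ hv⟩)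
    (by
      intro v
      by_cases hv : v.Occurs (k * c ^ 2)
      · have := D.preconnected ⟨v, hv⟩
        convert this using 3
        all_goals simp [hv]
      · rintro ⟨i, hi⟩
        obtain ⟨w, -, rfl⟩ := Finset.mem_map.1 hi
        exact absurd w.2 hv)
    (by
      intro j s
      by_contra hnot
      obtain ⟨h1, h2⟩ := shift_add_one_ne hk s j
      have hlink : ∀ u, u ≠ shift s j + 1 →
          ReachableIn (T.map (Function.Embedding.subtype _))
            (insert (.base u) (descendants j (shift s j + 1) []))
            (.new j (shift s j + 1) []) (.base u) := fun u hu =>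
        (isSpannerBelow_map (by omega) hT (Set.subset_insert ..)).reachableIn hc hu
      -- Both base vertices are linked to the new vertex of their child, hence to each other.
      rcases ReachableIn.not_or_not hnot (.new j (shift s j + 1) []) with h | h
      · exact h ((hlink s h1).mono (Set.subset_insert ..))
      · exact h ((hlink _ h2).mono (Set.insert_subset_insert (Set.subset_insert ..))))
  rw [Finset.card_map] at hi
  have := hD i
  omega

end Spanner

end SpannerTreewidth

theorem mainTheorem2 (k : ℕ) (hk : 3 ≤ k) :
    (∀ c : ℕ, 1 ≤ c →
      SpannerTreewidth.IsKTree k (SpannerTreewidth.snowflake k (k * c ^ 2)) ∧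
      SpannerTreewidth.treewidth (SpannerTreewidth.snowflake k (k * c ^ 2)) = (k : ℕ∞) ∧
      ¬ ∃ T : SimpleGraph {v : SpannerTreewidth.SnowVertex k // v.Occurs (k * c ^ 2)},
          SpannerTreewidth.IsAdditiveSpanner c T
              (SpannerTreewidth.snowflake k (k * c ^ 2)) ∧
            SpannerTreewidth.treewidth T ≤ ((k - 1 : ℕ) : ℕ∞)) ∧
    ¬ ∃ c : ℕ, ∀ (V : Type) (_ : Finite V) (G : SimpleGraph V), G.Connected →
        SpannerTreewidth.treewidth G = (k : ℕ∞) →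
          ∃ T : SimpleGraph V, SpannerTreewidth.IsAdditiveSpanner c T G ∧
            SpannerTreewidth.treewidth T ≤ ((k - 1 : ℕ) : ℕ∞) := by
  refine ⟨fun c hc => ⟨SpannerTreewidth.isKTree_snowflake k _,
    SpannerTreewidth.treewidth_snowflake (by omega), ?_⟩, ?_⟩
  · rintro ⟨T, hT, htw⟩
    exact SpannerTreewidth.not_treewidth_le_of_isAdditiveSpanner hk hc hT htw
  · rintro ⟨c, hc⟩
    -- The case `c = 0` is not excluded here, so the snowflake for `c + 1` is used; a `c`-spanner is
    -- also a `c + 1`-spanner.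
    obtain ⟨T, hT, htw⟩ := hc _ (SpannerTreewidth.finite_snowVertex k (k * (c + 1) ^ 2))
      (SpannerTreewidth.snowflake k _) (SpannerTreewidth.connected_snowflake (by omega))
      (SpannerTreewidth.treewidth_snowflake (by omega))
    refine SpannerTreewidth.not_treewidth_le_of_isAdditiveSpanner hk (Nat.le_add_left 1 c)
      ⟨hT.1, fun u v => (hT.2 u v).trans ?_⟩ htw
    gcongr
    exact Nat.le_succ c
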